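/- Let $\kappa$ be a singular strong limit cardinal (i.e. an infinite cardinal with $\mathrm{cf}(\kappa)<\kappa$ such that $2^\mu<\kappa$ for every cardinal $\mu<\kappa$). Then for every ordinal $\lambda<\kappa$ (in particular, for every cardinal $\lambda<\kappa$) we have $\kappa\to^{poly}(\kappa)^2_{\lambda\text{-}bdd}$; that is, for every $f:[\kappa]^2\to\kappa$ such that $|f^{-1}\{\alpha\}|\le\lambda$ for all $\alpha\in\kappa$, there is a set $A\subseteq\kappa$ of order type $\kappa$ such that $f\restriction[A]^2$ is injective. (Here $[X]^2$ is the set of two-element subsets of $X$.) -/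

import Mathlib

open Cardinal Ordinal

universe u

/-- An `n`-coloring `f : [μ]ⁿ → μ` of an ordinal `μ` is `i`-bounded if every color class has
cardinality (regarded as an initial ordinal) at most the ordinal `i`. -/
def IsBoundedColoring {μ : Ordinal.{u}} {n : ℕ} (i : Ordinal.{u})
    (f : Set.powersetCard μ.ToType n → μ.ToType) : Prop :=
  ∀ γ : μ.ToType, (#(f ⁻¹' {γ})).ord ≤ i

/-- `A ⊆ μ` is a rainbow set for `f : [μ]ⁿ → μ` if `f` is injective on `[A]ⁿ`. -/
def IsRainbow {μ : Ordinal.{u}} {n : ℕ}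
    (f : Set.powersetCard μ.ToType n → μ.ToType) (A : Set μ.ToType) : Prop :=
  Set.InjOn f {a | ((a : Finset μ.ToType) : Set μ.ToType) ⊆ A}

/-- The rainbow partition relation `μ →^{poly} (η)ⁿ_{i-bdd}` between ordinals: every `i`-bounded
`f : [μ]ⁿ → μ` has a rainbow set `A ⊆ μ` of order type `η`. -/
def PolyArrow (μ η : Ordinal.{u}) (n : ℕ) (i : Ordinal.{u}) : Prop :=
  ∀ f : Set.powersetCard μ.ToType n → μ.ToType, IsBoundedColoring i f →
    ∃ A : Set μ.ToType, typeLT A = η ∧ IsRainbow f A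

/-! Build a sequence `x α` whose colors to earlier terms never occur among those terms; then only
two edges with the same later endpoint can clash. To control these, fix fewer than `κ` vertices `y`,
one per member of a cofinal set, each fresh over a hull of size below `κ` (strong limit). Each `x α`
copies some `y`: it identifies two earlier terms only if `y` does. Boundedness makes each `y`
identify a term with few others, so a graph of small degree records all clashes, and an independent
set of size `κ` is rainbow (`exists_fresh_sequence`, `exists_independent_set`). -/

/-- `M` is closed under `G` applied to subsets of size at most `χ` and relations on them. -/
def IsClosedUnder {V : Type u} (G : Set V → Set (V × V) → V) (χ : Cardinal.{u}) (M : Set V) :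
    Prop :=
  ∀ s ⊆ M, #s ≤ χ → ∀ R ⊆ s ×ˢ s, G s R ∈ M

/-- The least set closed under `G` in the sense of `IsClosedUnder`. -/
def leastClosed {V : Type u} (G : Set V → Set (V × V) → V) (χ : Cardinal.{u}) : Set V :=
  ⋂₀ {M | IsClosedUnder G χ M}

theorem isClosedUnder_leastClosed {V : Type u} (G : Set V → Set (V × V) → V) (χ : Cardinal.{u}) :
    IsClosedUnder G χ (leastClosed G χ) := fun s hs hc R hR M hM =>
  hM s (fun _ hx => hs hx M hM) hc R hR

theorem leastClosed_mono {V : Type u} (G : Set V → Set (V × V) → V) {χ χ' : Cardinal.{u}}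
    (h : χ ≤ χ') : leastClosed G χ ⊆ leastClosed G χ' := fun _ hx M hM =>
  hx M fun s hs hc R hR => hM s hs (hc.trans h) R hR

/-- Values of well-founded trees already form a closed set. Each node carries one of `2 ^ χ` codes
and has at most `χ` children, and `(2 ^ χ) ^ χ = 2 ^ χ`. -/
theorem mk_leastClosed_le {V : Type u} (G : Set V → Set (V × V) → V) {χ : Cardinal.{u}}
    (hχ : ℵ₀ ≤ χ) : #(leastClosed G χ) ≤ 2 ^ χ := by
  obtain ⟨I, rfl⟩ : ∃ I : Type u, #I = χ := ⟨χ.out, χ.mk_out⟩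
  let α := Σ T : Set I, Set (T × T)
  let β : α → Type u := fun a => a.1
  have h2 : ℵ₀ ≤ (2 : Cardinal.{u}) ^ #I := hχ.trans (cantor _).le
  have hα : #α ≤ 2 ^ #I := by
    have hT : ∀ T : Set I, #(Set (T × T)) ≤ 2 ^ #I := fun T => by
      rw [mk_set]
      refine power_le_power_left two_ne_zero ?_
      rw [mk_prod, Cardinal.lift_id]
      exact (mul_le_mul' (mk_set_le T) (mk_set_le T)).trans (mul_eq_self hχ).le
    calc #α = sum fun T : Set I => #(Set (T × T)) := mk_sigma _
      _ ≤ sum fun _ : Set I => 2 ^ #I := sum_le_sum _ _ hT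
      _ = 2 ^ #I := by rw [sum_const', mk_set, mul_eq_self h2]
  have hW : #(WType β) ≤ 2 ^ #I := by
    refine WType.cardinalMk_le_of_le ?_
    calc (sum fun a : α => ((2 : Cardinal.{u}) ^ #I) ^ #(β a)) ≤ sum fun _ : α => 2 ^ #I := by
          refine sum_le_sum _ _ fun a => ?_
          rw [← power_mul]
          exact power_le_power_left two_ne_zero
            ((mul_le_mul' le_rfl (mk_set_le a.1)).trans (mul_eq_self hχ).le)
      _ = #α * 2 ^ #I := sum_const' _ _
      _ ≤ 2 ^ #I * 2 ^ #I := mul_le_mul' hα le_rfl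
      _ = 2 ^ #I := mul_eq_self h2
  let ev : WType β → V := WType.elim V fun p : Σ a : α, β a → V =>
    G (Set.range p.2) (Prod.map p.2 p.2 '' p.1.2)
  have hcl : IsClosedUnder G #I (Set.range ev) := by
    intro s hs hc R hR
    obtain ⟨T, ⟨e⟩⟩ : ∃ T : Set I, Nonempty (T ≃ s) := by
      obtain ⟨T, hT⟩ := le_mk_iff_exists_set.1 hc
      exact ⟨T, Cardinal.eq.1 hT⟩
    choose w hw using fun x : s => hs x.2
    let h : T → V := fun t => (e t : V)
    let Q : Set (T × T) := Prod.map h h ⁻¹' R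
    refine ⟨WType.mk (⟨T, Q⟩ : α) fun t => w (e t), ?_⟩
    have hrange : Set.range h = s := by
      ext v
      constructor
      · rintro ⟨t, rfl⟩
        exact (e t).2
      · exact fun hv => ⟨e.symm ⟨v, hv⟩, by simp [h]⟩
    have himage : Prod.map h h '' Q = R := by
      refine Set.image_preimage_eq_of_subset fun p hp => ?_
      rw [Set.range_prodMap, hrange]
      exact hR hp
    have hev : ev (WType.mk (⟨T, Q⟩ : α) fun t => w (e t)) =
        G (Set.range fun t => ev (w (e t)))
          (Prod.map (fun t => ev (w (e t))) (fun t => ev (w (e t))) '' Q) := rfl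
    have hfun : (fun t => ev (w (e t))) = h := funext fun t => hw (e t)
    rw [hev, hfun, hrange, himage]
  exact (mk_le_mk_of_subset (Set.sInter_subset_of_mem hcl)).trans (mk_range_le.trans hW)

theorem mk_iUnion_le_mul {ι V : Type u} {s : ι → Set V} {c : Cardinal.{u}}
    (h : ∀ i, #(s i) ≤ c) : #(⋃ i, s i) ≤ #ι * c :=
  mk_iUnion_le_sum_mk.trans ((sum_le_sum _ _ h).trans (sum_const' _ _).le)

/-- `y` lies outside `s`, and the colors joining `y` to `s` do not occur inside `s`. -/
def IsFresh {V W : Type u} (F : V → V → W) (s : Set V) (y : V) : Prop :=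
  y ∉ s ∧ ∀ a ∈ s, ∀ b ∈ s, ∀ c ∈ s, b ≠ c → F y a ≠ F b c

theorem IsFresh.mono {V W : Type u} {F : V → V → W} {s t : Set V} {y : V} (h : IsFresh F t y)
    (hst : s ⊆ t) : IsFresh F s y :=
  ⟨fun hy => h.1 (hst hy), fun a ha b hb c hc => h.2 a (hst ha) b (hst hb) c (hst hc)⟩

section Coloring

variable {V W : Type u} {F : V → V → W} {ν : Cardinal.{u}}

theorem exists_isFresh (hV : ℵ₀ ≤ #V) (hν : ν < #V)
    (hF : ∀ c, #{p : V × V | p.1 ≠ p.2 ∧ F p.1 p.2 = c} ≤ ν) {s : Set V} (hs : #s < #V) :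
    ∃ y, IsFresh F s y := by
  let T : s × s → Set V := fun q => Prod.fst '' {p : V × V | p.1 ≠ p.2 ∧ F p.1 p.2 = F q.1 q.2}
  have hT : #(⋃ q, T q : Set V) < #V := by
    refine (mk_iUnion_le_mul fun q : s × s => mk_image_le.trans (hF (F q.1 q.2))).trans_lt ?_
    rw [mk_prod, Cardinal.lift_id]
    exact mul_lt_of_lt hV (mul_lt_of_lt hV hs hs) hν
  have hU : #(s ∪ ⋃ q, T q : Set V) < #V := (mk_union_le _ _).trans_lt (add_lt_of_lt hV hs hT)
  obtain ⟨y, hy⟩ : ∃ y, y ∉ (s ∪ ⋃ q, T q : Set V) := by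
    by_contra! h
    rw [Set.eq_univ_of_forall h, mk_univ] at hU
    exact hU.false
  refine ⟨y, fun h => hy (Or.inl h), fun a ha b hb c hc _ heq => hy (Or.inr ?_)⟩
  exact Set.mem_iUnion.2 ⟨(⟨b, hb⟩, ⟨c, hc⟩), (y, a),
    ⟨fun h : y = a => hy (Or.inl (h ▸ ha)), heq⟩, rfl⟩

theorem exists_fresh_sequence [LinearOrder V] [WellFoundedLT V] (hord : ord #V = typeLT V)
    (hω : ℵ₀ < #V) (hlim : (#V).IsStrongLimit) (hcof : Order.cof V < #V) (hν : ν < #V)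
    (hF : ∀ c, #{p : V × V | p.1 ≠ p.2 ∧ F p.1 p.2 = c} ≤ ν) :
    ∃ (x : V → V) (Y : Set V), #Y < #V ∧ ∀ α, IsFresh F (x '' Set.Iio α) (x α) ∧
      ∃ y ∈ Y, y ∉ x '' Set.Iio α ∧ ∀ a ∈ x '' Set.Iio α, ∀ b ∈ x '' Set.Iio α,
        F (x α) a = F (x α) b → F y a = F y b := by
  classical
  have hV : ℵ₀ ≤ #V := hω.le
  have : Nonempty V := mk_ne_zero_iff.1 (aleph0_pos.trans_le hV).ne'
  let P : Set V → Set (V × V) → V → Prop := fun s R x =>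
    IsFresh F s x ∧ ∀ a ∈ s, ∀ b ∈ s, F x a = F x b → (a, b) ∈ R
  let G : Set V → Set (V × V) → V := fun s R => Classical.epsilon (P s R)
  have hG : ∀ s R, (∃ x, P s R x) → P s R (G s R) := fun s R h => Classical.epsilon_spec h
  obtain ⟨S, hS, hScard⟩ := Order.exists_cof_eq V
  -- Taking the least member of `S` above `α` makes `j` monotone, so the hulls `M (j α)` increase
  -- with `α`.
  let j : V → V := fun α => WellFounded.min (wellFounded_lt (α := V)) {i | i ∈ S ∧ α ≤ i} (hS α)
  have hj : ∀ α, j α ∈ S ∧ α ≤ j α := fun α => WellFounded.min_mem _ _ (hS α)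
  have hjmono : Monotone j := fun α β h =>
    not_lt.1 (WellFounded.not_lt_min _ {i | i ∈ S ∧ α ≤ i} ⟨(hj β).1, h.trans (hj β).2⟩)
  let χ : V → Cardinal.{u} := fun i => max ℵ₀ #(Set.Iic i)
  have hχmono : Monotone χ := fun a b h =>
    max_le_max le_rfl (mk_le_mk_of_subset (Set.Iic_subset_Iic.2 h))
  let M : V → Set V := fun i => leastClosed G (χ i)
  have hχ : ∀ i, χ i < #V := fun i => max_lt hω (mk_Iic_lt i hord hV)
  have hMcard : ∀ i, #(M i) < #V := fun i =>
    (mk_leastClosed_le G (le_max_left _ _)).trans_lt (hlim.isStrongPrelimit (hχ i))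
  choose y hy using fun i => exists_isFresh hV hν hF (hMcard i)
  let E : V → Set V → Set (V × V) := fun α s =>
    {p | (p.1 ∈ s ∧ p.2 ∈ s) ∧ F (y (j α)) p.1 = F (y (j α)) p.2}
  -- `y (j α)` enters only through the relation it induces on earlier terms, so `x α` stays in the
  -- hull `M (j α)` over which `y (j α)` is fresh.
  let x : V → V := WellFounded.fix (wellFounded_lt (α := V)) fun α ih =>
    let s := Set.range fun β : Set.Iio α => ih β.1 β.2
    G s (E α s)
  have hx : ∀ α, x α = G (x '' Set.Iio α) (E α (x '' Set.Iio α)) := fun α => by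
    rw [Set.image_eq_range]
    exact WellFounded.fix_eq _ _ α
  have hM : ∀ α, x α ∈ M (j α) := fun α => by
    induction α using WellFoundedLT.induction with | _ α ih =>
    rw [hx α]
    refine isClosedUnder_leastClosed G (χ (j α)) _ ?_ ?_ _ fun p hp => hp.1
    · rintro _ ⟨β, hβ, rfl⟩
      exact leastClosed_mono G (hχmono (hjmono (le_of_lt hβ))) (ih β hβ)
    · refine mk_image_le.trans (le_trans (mk_le_mk_of_subset fun β hβ => ?_) (le_max_right _ _))
      exact (le_of_lt hβ).trans (hj α).2
  have hsub : ∀ α, x '' Set.Iio α ⊆ M (j α) := by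
    rintro α _ ⟨β, hβ, rfl⟩
    exact leastClosed_mono G (hχmono (hjmono (le_of_lt hβ))) (hM β)
  refine ⟨x, y '' S, mk_image_le.trans_lt (hScard.trans_lt hcof), fun α => ?_⟩
  have hfresh := (hy (j α)).mono (hsub α)
  -- `y (j α)` itself witnesses that the choice is possible.
  have hP := hG (x '' Set.Iio α) (E α (x '' Set.Iio α))
    ⟨y (j α), hfresh, fun a ha b hb h => ⟨⟨ha, hb⟩, h⟩⟩
  rw [← hx α] at hP
  exact ⟨hP.1, y (j α), ⟨_, (hj α).1, rfl⟩, hfresh.1, fun a ha b hb h => (hP.2 a ha b hb h).2⟩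

/-- A relation on a set of infinite size `#V` all of whose neighborhoods have size at most
`d < #V` has an independent set of full size. -/
theorem exists_independent_set (hV : ℵ₀ ≤ #V) {r : V → V → Prop} (hr : ∀ a b, r a b → r b a)
    {d : Cardinal.{u}} (hd : d < #V) (hdeg : ∀ a, #{b | r a b} ≤ d) :
    ∃ I : Set V, #I = #V ∧ I.Pairwise fun a b => ¬ r a b := by
  obtain ⟨I, hI⟩ := zorn_subset {I : Set V | I.Pairwise fun a b => ¬ r a b} fun c hc hchain =>
    ⟨⋃₀ c, (Set.pairwise_sUnion hchain.directedOn).2 hc, fun s hs => Set.subset_sUnion_of_mem hs⟩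
  refine ⟨I, le_antisymm (mk_set_le I) (not_lt.1 fun hlt => ?_), hI.1⟩
  have hcover : I ∪ ⋃ a : I, {b | r a b} = Set.univ := by
    refine Set.eq_univ_of_forall fun b => ?_
    by_contra hb
    simp only [Set.mem_union, Set.mem_iUnion, Set.mem_ofPred_eq, not_or, not_exists] at hb
    refine hb.1 (hI.2 ?_ (Set.subset_insert b I) (Set.mem_insert b I))
    exact hI.1.insert fun a ha _ => ⟨fun h => hb.2 ⟨a, ha⟩ (hr _ _ h), hb.2 ⟨a, ha⟩⟩
  have hlt' : #(I ∪ ⋃ a : I, {b | r a b} : Set V) < #V :=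
    (mk_union_le _ _).trans_lt (add_lt_of_lt hV hlt
      ((mk_iUnion_le_mul fun a : I => hdeg a).trans_lt (mul_lt_of_lt hV hlt hd)))
  rw [hcover, mk_univ] at hlt'
  exact hlt'.false

theorem exists_rainbow_set [LinearOrder V] [WellFoundedLT V] (hord : ord #V = typeLT V)
    (hω : ℵ₀ < #V) (hlim : (#V).IsStrongLimit) (hcof : Order.cof V < #V) (hν : ν < #V)
    (hsymm : ∀ a b, F a b = F b a)
    (hF : ∀ c, #{p : V × V | p.1 ≠ p.2 ∧ F p.1 p.2 = c} ≤ ν) :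
    ∃ A : Set V, #A = #V ∧ ∀ a ∈ A, ∀ b ∈ A, ∀ c ∈ A, ∀ d ∈ A, a ≠ b → c ≠ d →
      F a b = F c d → (a = c ∧ b = d) ∨ (a = d ∧ b = c) := by
  have hV : ℵ₀ ≤ #V := hω.le
  obtain ⟨x, Y, hY, hx⟩ := exists_fresh_sequence hord hω hlim hcof hν hF
  have hinj : Function.Injective x := by
    refine fun α β heq => ?_
    rcases lt_trichotomy α β with h | h | h
    · exact ((hx β).1.1 ⟨α, h, heq⟩).elim
    · exact h
    · exact ((hx α).1.1 ⟨β, h, heq.symm⟩).elim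
  let r : V → V → Prop := fun α β =>
    ∃ y ∈ Y, y ≠ x α ∧ y ≠ x β ∧ F y (x α) = F y (x β)
  obtain ⟨I, hI, hind⟩ := exists_independent_set hV (r := r)
    (fun _ _ ⟨y, h, h1, h2, h3⟩ => ⟨y, h, h2, h1, h3.symm⟩) (mul_lt_of_lt hV hY hν) fun α => by
      have hsub : {β | r α β} ⊆ ⋃ y : Y, {β | (y : V) ≠ x β ∧ F y (x β) = F y (x α)} := by
        rintro β ⟨y, h, -, h2, h3⟩
        exact Set.mem_iUnion.2 ⟨⟨y, h⟩, h2, h3.symm⟩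
      refine (mk_le_mk_of_subset hsub).trans (mk_iUnion_le_mul fun y => ?_)
      refine le_trans ?_ (hF (F y (x α)))
      refine mk_le_of_injective
        (f := fun β => ⟨((y : V), x β.1), β.2⟩) fun β γ h => Subtype.ext (hinj ?_)
      exact congrArg (fun p => p.1.2) h
  have hlast : ∀ α ∈ I, ∀ β ∈ I, ∀ γ ∈ I, ∀ δ ∈ I, β < α → γ < δ → δ ≤ α →
      F (x α) (x β) = F (x δ) (x γ) → α = δ ∧ β = γ := by
    intro α hα β hβ γ hγ δ hδ hβα hγδ hδα heq
    obtain ⟨hfresh, y, hyY, hy, hyF⟩ := hx α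
    have hmem : ∀ {ε}, ε < α → x ε ∈ x '' Set.Iio α := fun h => ⟨_, h, rfl⟩
    -- Different later endpoints contradict freshness; equal ones contradict independence.
    rcases hδα.lt_or_eq with hlt | rfl
    · exact absurd heq (hfresh.2 _ (hmem hβα) _ (hmem hlt) _ (hmem (hγδ.trans hlt))
        (hinj.ne hγδ.ne'))
    · refine ⟨rfl, by_contra fun hne => hind hβ hγ hne ⟨y, hyY, ?_, ?_, ?_⟩⟩
      · exact fun h => hy (h ▸ hmem hβα)
      · exact fun h => hy (h ▸ hmem hγδ)
      · exact hyF _ (hmem hβα) _ (hmem hγδ) heq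
  have hlt : ∀ α ∈ I, ∀ β ∈ I, ∀ γ ∈ I, ∀ δ ∈ I, β < α → γ < δ →
      F (x α) (x β) = F (x δ) (x γ) → α = δ ∧ β = γ := by
    intro α hα β hβ γ hγ δ hδ hβα hγδ heq
    rcases le_total δ α with h | h
    · exact hlast α hα β hβ γ hγ δ hδ hβα hγδ h heq
    · have := hlast δ hδ γ hγ β hβ α hα hγδ hβα h heq.symm
      exact ⟨this.1.symm, this.2.symm⟩
  refine ⟨x '' I, (mk_image_eq hinj).trans hI, ?_⟩
  rintro _ ⟨α, hα, rfl⟩ _ ⟨β, hβ, rfl⟩ _ ⟨γ, hγ, rfl⟩ _ ⟨δ, hδ, rfl⟩ hab hcd heq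
  rcases lt_or_gt_of_ne (fun h => hab (congrArg x h)) with h1 | h1 <;>
    rcases lt_or_gt_of_ne (fun h => hcd (congrArg x h)) with h2 | h2
  · rw [hsymm (x α), hsymm (x γ)] at heq
    obtain ⟨rfl, rfl⟩ := hlt β hβ α hα γ hγ δ hδ h1 h2 heq
    exact Or.inl ⟨rfl, rfl⟩
  · rw [hsymm (x α)] at heq
    obtain ⟨rfl, rfl⟩ := hlt β hβ α hα δ hδ γ hγ h1 h2 heq
    exact Or.inr ⟨rfl, rfl⟩
  · rw [hsymm (x γ)] at heq
    obtain ⟨rfl, rfl⟩ := hlt α hα β hβ γ hγ δ hδ h1 h2 heq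
    exact Or.inr ⟨rfl, rfl⟩
  · obtain ⟨rfl, rfl⟩ := hlt α hα β hβ δ hδ γ hγ h1 h2 heq
    exact Or.inl ⟨rfl, rfl⟩

end Coloring

theorem mainTheorem8 (κ : Cardinal.{u}) (hsing : κ.IsSingular) (hlim : κ.IsStrongLimit)
    (i : Ordinal.{u}) (hi : i < κ.ord) :
    PolyArrow κ.ord κ.ord 2 i := by
  classical
  intro f hf
  let V := κ.ord.ToType
  have hVκ : #V = κ := mk_ord_toType κ
  have hord : ord #V = typeLT V := by rw [hVκ]; exact (Ordinal.type_toType _).symm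
  have hcof : Order.cof V < #V := by
    rw [hVκ]
    exact (Ordinal.cof_toType _).trans_lt hsing.cof_ord_lt
  have : Nonempty V := mk_ne_zero_iff.1 (by rw [hVκ]; exact hsing.pos.ne')
  let F : V → V → V := fun a b =>
    if h : a ≠ b then f ⟨{a, b}, Finset.card_pair h⟩ else Classical.arbitrary V
  have hFne : ∀ {a b} (h : a ≠ b), F a b = f ⟨{a, b}, Finset.card_pair h⟩ := fun h => dif_pos h
  have hsymm : ∀ a b, F a b = F b a := fun a b => by
    by_cases h : a = b
    · rw [h]
    · rw [hFne h, hFne (Ne.symm h)]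
      exact congrArg f (Subtype.ext (Finset.pair_comm a b))
  have hcard : i.card < κ := lt_ord.1 hi
  have hclass : ∀ c, #(f ⁻¹' {c}) ≤ i.card := fun c => by
    simpa using Ordinal.card_le_card (hf c)
  -- Each pair yields finitely many ordered pairs; the crude factor `ℵ₀` is harmless as `κ` is
  -- uncountable.
  have hF : ∀ c, #{p : V × V | p.1 ≠ p.2 ∧ F p.1 p.2 = c} ≤ ℵ₀ * i.card := fun c => by
    have hsub : {p : V × V | p.1 ≠ p.2 ∧ F p.1 p.2 = c} ⊆
        ⋃ e : f ⁻¹' {c}, {p : V × V | p.1 ∈ e.1.1 ∧ p.2 ∈ e.1.1} := by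
      rintro ⟨a, b⟩ ⟨h, hc⟩
      rw [hFne h] at hc
      exact Set.mem_iUnion.2 ⟨⟨_, hc⟩, by simp⟩
    refine (mk_le_mk_of_subset hsub).trans ((mk_iUnion_le_mul (c := ℵ₀) fun e => ?_).trans ?_)
    · have hfin : {p : V × V | p.1 ∈ e.1.1 ∧ p.2 ∈ e.1.1}.Finite :=
        (e.1.1 ×ˢ e.1.1).finite_toSet.subset fun p hp => by simpa using! hp
      exact hfin.lt_aleph0.le
    · rw [mul_comm]
      exact mul_le_mul' le_rfl (hclass c)
  have hω : ℵ₀ < κ :=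
    hsing.aleph0_le.lt_of_ne fun h => not_isSingular_aleph0 (h ▸ hsing)
  obtain ⟨A, hA, hrainbow⟩ := exists_rainbow_set hord (by rwa [hVκ]) (by rwa [hVκ]) hcof
    (by rw [hVκ]; exact mul_lt_of_lt hlim.aleph0_le hω hcard) hsymm hF
  refine ⟨A, le_antisymm ?_ ?_, ?_⟩
  · exact (Ordinal.type_set_le A).trans_eq (Ordinal.type_toType _)
  · rw [ord_le, Ordinal.card_type, hA, hVκ]
  · rintro ⟨s, hs⟩ hsA ⟨t, ht⟩ htA heq
    obtain ⟨a, b, hab, rfl⟩ := Finset.card_eq_two.1 hs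
    obtain ⟨c, d, hcd, rfl⟩ := Finset.card_eq_two.1 ht
    have hsA' : (({a, b} : Finset V) : Set V) ⊆ A := hsA
    have htA' : (({c, d} : Finset V) : Set V) ⊆ A := htA
    have heq' : F a b = F c d := by
      rw [hFne hab, hFne hcd]
      exact heq
    rcases hrainbow a (hsA' (by simp)) b (hsA' (by simp)) c (htA' (by simp)) d (htA' (by simp))
      hab hcd heq' with ⟨rfl, rfl⟩ | ⟨rfl, rfl⟩
    · rfl
    · exact Subtype.ext (Finset.pair_comm _ _)
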